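/- For a partition $\pi$ of a nonnegative integer $n$, the \emph{rank} of $\pi$ is its largest part minus its number of parts. The \emph{crank} of $\pi$ is the largest part of $\pi$ if $\pi$ has no part equal to $1$; if $\pi$ has $\omega\ge 1$ parts equal to $1$, the crank is the number of parts of $\pi$ larger than $\omega$, minus $\omega$. Let $N(m,n)$ be the number of partitions of $n$ with rank $m$, and, for $n\neq 1$, let $M(m,n)$ be the number of partitions of $n$ with crank $m$; for $n=1$ put $M(-1,1)=M(1,1)=1$, $M(0,1)=-1$, and $M(m,1)=0$ for all other $m$. For $j\ge 0$ define the $j$-th rank moment and the $j$-th crank moment by $$N_j(n)=\sum_{m=-n}^{n} m^j N(m,n),\qquad M_j(n)=\sum_{m=-n}^{n} m^j M(m,n).$$ Then for all integers $k\ge 1$ and $n\ge 1$ (in particular whenever $1\le k\le n$), $$M_{2k}(n)>N_{2k}(n).$$ -/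

import Mathlib

namespace PartitionMoments

/-- Dyson's rank of a partition: the largest part minus the number of parts. -/
def rank {n : ℕ} (p : n.Partition) : ℤ :=
  (p.parts.sup : ℤ) - (Multiset.card p.parts : ℤ)

/-- The Andrews–Garvan crank of a partition. Let `ω` be the number of ones. If `ω = 0`, the crank is
the largest part; otherwise it is the number of parts larger than `ω`, minus `ω`. -/
def crank {n : ℕ} (p : n.Partition) : ℤ :=
  if p.parts.count 1 = 0 then (p.parts.sup : ℤ)
  else (p.parts.countP (fun i => p.parts.count 1 < i) : ℤ) - (p.parts.count 1 : ℤ)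

/-- `N(m, n)`: the number of partitions of `n` with rank `m`. -/
def rankCount (m : ℤ) (n : ℕ) : ℤ :=
  ((Finset.univ.filter fun p : n.Partition => rank p = m).card : ℤ)

/-- `M(m, n)`: the number of partitions of `n` with crank `m` for `n ≠ 1`, with the usual
convention `M(-1, 1) = M(1, 1) = 1`, `M(0, 1) = -1` and `M(m, 1) = 0` otherwise. -/
def crankCount (m : ℤ) (n : ℕ) : ℤ :=
  if n = 1 then
    if m = -1 ∨ m = 1 then 1 else if m = 0 then -1 else 0
  else ((Finset.univ.filter fun p : n.Partition => crank p = m).card : ℤ)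

/-- The `j`-th rank moment `N_j(n) = ∑_{m=-n}^{n} m^j N(m, n)`. -/
noncomputable def rankMoment (j n : ℕ) : ℤ :=
  ∑ m ∈ Finset.Icc (-(n : ℤ)) (n : ℤ), m ^ j * rankCount m n

/-- The `j`-th crank moment `M_j(n) = ∑_{m=-n}^{n} m^j M(m, n)`. -/
noncomputable def crankMoment (j n : ℕ) : ℤ :=
  ∑ m ∈ Finset.Icc (-(n : ℤ)) (n : ℤ), m ^ j * crankCount m n

end PartitionMoments

open Finset PowerSeries

namespace PartitionMoments

/-! ### Truncated q-series: two evaluations of one Heine-type sum. -/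

section QSeries

variable {B : Type*} [CommRing B]

/-! Let R and C be the rank and crank generating functions in q and z, and a = 1/z. The core is the
identity R = C - (z + a - 2) S (`rankSeries_eq`), with S the series `sptSum`. It comes from
computing Σ (a)_n (z)_n q^n / (q)_n in two ways. Directly, the term n = 0 gives C, and every other
term contains (1 - a)(1 - z) = -(z + a - 2), leaving S (`prod_mul_heineSum`). Iterating a functional
equation z → zq instead gives a series that telescopes to R (`heineSum_eq_sum`,
`sum_geometric_telescope`).

Now put z = e^t. The coefficient of t^(2k) q^n, times (2k)!, is the 2k-th moment (for n ≥ 2), so the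
difference of moments is read off from (e^t + e^(-t) - 2) S. Both factors have nonnegative
coefficients: each factor (1 - q^m) / ((1 - zq^m)(1 - aq^m)) in S is 1 plus a nonnegative series
(`exists_factor_eq`). Strictness holds because S dominates q/(1 - q).

Infinite products are avoided by assuming q^(M+1) = 0, which is later realised in the quotient by
X^(n+1). -/

/-- The finite `q`-Pochhammer symbol `(c; q)_n`. -/
def qPoch (q c : B) (n : ℕ) : B := ∏ i ∈ range n, (1 - c * q ^ i)

@[simp] lemma qPoch_zero (q c : B) : qPoch q c 0 = 1 := by simp [qPoch]

lemma qPoch_succ (q c : B) (n : ℕ) : qPoch q c (n + 1) = qPoch q c n * (1 - c * q ^ n) := by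
  simp [qPoch, prod_range_succ]

lemma qPoch_succ' (q c : B) (n : ℕ) : qPoch q c (n + 1) = (1 - c) * qPoch q (c * q) n := by
  rw [qPoch, prod_range_succ', mul_comm, qPoch]
  simp only [pow_zero, mul_one]
  congr 1
  exact prod_congr rfl fun i _ => by ring

lemma qPoch_zero_left (q : B) (n : ℕ) : qPoch q 0 n = 1 := by simp [qPoch]

lemma qPoch_add (q c : B) (m n : ℕ) :
    qPoch q c (m + n) = qPoch q c m * qPoch q (c * q ^ m) n := by
  rw [qPoch, prod_range_add, qPoch, qPoch]
  congr 1
  exact prod_congr rfl fun i _ => by ring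

lemma qPoch_add_of_pow_eq_zero {q c : B} {m : ℕ} (h : c * q ^ m = 0) (n : ℕ) :
    qPoch q c (m + n) = qPoch q c m := by
  rw [qPoch_add, h, qPoch_zero_left, mul_one]

/-- The sum `∑_{n ≤ M} (a)_n (b)_n q^n (q^{n+1})_{M-n}`, a truncated `₂φ₁(a, b; 0; q, q)` with
denominators cleared. -/
def heineSum (q a b : B) : ℕ → B
  | 0 => 1
  | M + 1 => (1 - q ^ (M + 1)) * heineSum q a b M +
      qPoch q a (M + 1) * qPoch q b (M + 1) * q ^ (M + 1)

/-- The first-order q-difference equation in `b`; its right side is a pure product, so iteration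
sums the series. -/
lemma heineSum_sub (q a b : B) (M : ℕ) :
    heineSum q a b M - a * heineSum q a (b * q) M = qPoch q a (M + 1) * qPoch q (b * q) M := by
  induction M with
  | zero => simp [heineSum, qPoch]
  | succ M ih =>
    have h : heineSum q a b (M + 1) - a * heineSum q a (b * q) (M + 1) =
        (1 - q ^ (M + 1)) * (heineSum q a b M - a * heineSum q a (b * q) M) +
        qPoch q a (M + 1) * q ^ (M + 1) *
          (qPoch q b (M + 1) - a * qPoch q (b * q) (M + 1)) := by
      simp only [heineSum]; ring
    rw [h, ih, qPoch_succ' q b, qPoch_succ q (b * q), qPoch_succ q a (M + 1)]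
    ring

lemma heineSum_zero (q a : B) (M : ℕ) : heineSum q a 0 M = qPoch q (a * q) M := by
  induction M with
  | zero => simp [heineSum]
  | succ M ih =>
    rw [heineSum, ih, qPoch_zero_left, qPoch_succ' q a, qPoch_succ]
    ring

lemma heineSum_eq_sum (q a b : B) (M J : ℕ) :
    heineSum q a b M = ∑ j ∈ range J, a ^ j * (qPoch q a (M + 1) * qPoch q (b * q ^ (j + 1)) M) +
      a ^ J * heineSum q a (b * q ^ J) M := by
  induction J with
  | zero => simp
  | succ J ih =>
    have h := heineSum_sub q a (b * q ^ J) M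
    rw [mul_assoc b, ← pow_succ] at h
    rw [ih, sum_range_succ, ← h]
    ring

/-- The truncated generating function `∑_{n ≤ M} q^n (q^{n+1})_{M-n} ∏_{n ≤ i ≤ M} d_i` of the
spt-crank, where `d i` plays the role of the factor belonging to `q ^ (i + 1)`. -/
def sptSum (q : B) (d : ℕ → B) : ℕ → B
  | 0 => 0
  | M + 1 => sptSum q d M * ((1 - q ^ (M + 1)) * d M) + q ^ (M + 1) * d M

lemma prod_mul_qPoch_of_inv {q c : B} {u : ℕ → B} (hu : ∀ i, u i * (1 - c * q ^ (i + 1)) = 1)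
    (n : ℕ) : (∏ i ∈ range n, u i) * qPoch q (c * q) n = 1 := by
  rw [qPoch, ← prod_mul_distrib]
  refine prod_eq_one fun i _ => ?_
  linear_combination hu i

/-- For n ≥ 1, (a)_n (z)_n = (1 - a)(1 - z)(aq)_(n-1) (zq)_(n-1), and the last two factors cancel
against the initial parts of the products of `u` and `v`. -/
lemma prod_mul_heineSum {q z a : B} (haz : a * z = 1) {u v : ℕ → B}
    (hu : ∀ i, u i * (1 - z * q ^ (i + 1)) = 1) (hv : ∀ i, v i * (1 - a * q ^ (i + 1)) = 1)
    (M : ℕ) :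
    (∏ i ∈ range M, u i) * (∏ i ∈ range M, v i) * heineSum q a z M =
      ∏ i ∈ range M, ((1 - q ^ (i + 1)) * (u i * v i)) -
        (z + a - 2) * sptSum q (fun i => u i * v i) M := by
  induction M with
  | zero => simp [heineSum, sptSum]
  | succ M ih =>
    have hU := prod_mul_qPoch_of_inv hu M
    have hV := prod_mul_qPoch_of_inv hv M
    rw [heineSum, sptSum, qPoch_succ' q a, qPoch_succ' q z, prod_range_succ, prod_range_succ,
      prod_range_succ]
    generalize ∏ i ∈ range M, u i = U at *
    generalize ∏ i ∈ range M, v i = V at *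
    generalize ∏ i ∈ range M, ((1 - q ^ (i + 1)) * (u i * v i)) = W at *
    generalize sptSum q (fun i => u i * v i) M = S at *
    linear_combination ((1 - q ^ (M + 1)) * u M * v M) * ih +
      ((1 - a) * (1 - z) * q ^ (M + 1) * u M * v M) * (V * qPoch q (a * q) M) * hU +
      ((1 - a) * (1 - z) * q ^ (M + 1) * u M * v M) * hV + q ^ (M + 1) * u M * v M * haz

/-- Summation by parts: since az = 1, the difference of consecutive products of `u` is z q^(j+1)
times the longer one, which lowers the power of a by one. -/
lemma sum_geometric_telescope {q z a : B} (haz : a * z = 1) {u : ℕ → B}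
    (hu : ∀ i, u i * (1 - z * q ^ (i + 1)) = 1) (M : ℕ) :
    (1 - a) * ∑ j ∈ range (M + 1), a ^ j * ∏ i ∈ range j, u i +
        a ^ (M + 1) * ∏ i ∈ range M, u i =
      1 + ∑ j ∈ range M, a ^ j * q ^ (j + 1) * ∏ i ∈ range (j + 1), u i := by
  induction M with
  | zero => simp
  | succ M ih =>
    rw [sum_range_succ _ (M + 1)]
    conv_rhs => rw [sum_range_succ, ← add_assoc, ← ih]
    rw [prod_range_succ]
    generalize ∏ i ∈ range M, u i = U
    linear_combination (a ^ (M + 1) * U) * hu M + a ^ M * q ^ (M + 1) * U * u M * haz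

/-- The identity between the rank, crank and spt-crank generating functions, truncated by
`q ^ (M + 1) = 0`. -/
theorem rankSeries_eq {q z a : B} {M : ℕ} (hq : q ^ (M + 1) = 0) (haz : a * z = 1) {u v : ℕ → B}
    (hu : ∀ i, u i * (1 - z * q ^ (i + 1)) = 1) (hv : ∀ i, v i * (1 - a * q ^ (i + 1)) = 1) :
    1 + ∑ j ∈ range M, a ^ j * q ^ (j + 1) * ∏ i ∈ range (j + 1), u i =
      ∏ i ∈ range M, ((1 - q ^ (i + 1)) * (u i * v i)) -
        (z + a - 2) * sptSum q (fun i => u i * v i) M := by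
  -- After M + 1 iterations the second argument z q^(M+1) is zero, so the remainder is the closed
  -- form `heineSum_zero`; it matches the boundary term of the telescoping.
  rw [← prod_mul_heineSum haz hu hv, ← sum_geometric_telescope haz hu,
    heineSum_eq_sum q a z M (M + 1), hq,
    mul_zero, heineSum_zero, mul_add, mul_sum, mul_sum]
  have hV := prod_mul_qPoch_of_inv hv M
  congr 1
  · refine sum_congr rfl fun j hj => ?_
    have hU := prod_mul_qPoch_of_inv hu M
    have hUj := prod_mul_qPoch_of_inv hu j
    have h1 : qPoch q (z * q) j * qPoch q (z * q ^ (j + 1)) M = qPoch q (z * q) M := by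
      rw [pow_succ', ← mul_assoc, ← qPoch_add, add_comm,
        qPoch_add_of_pow_eq_zero (by rw [mul_assoc, ← pow_succ', hq, mul_zero])]
    rw [qPoch_succ' q a]
    generalize ∏ i ∈ range M, u i = U at *
    generalize ∏ i ∈ range M, v i = V at *
    generalize ∏ i ∈ range j, u i = Uj at *
    rw [← h1] at hU
    linear_combination (-a ^ j * (1 - a) * Uj) * hU +
      (a ^ j * (1 - a) * U * qPoch q (z * q ^ (j + 1)) M) * hUj
      - (a ^ j * (1 - a) * U * qPoch q (z * q ^ (j + 1)) M) * hV
  · linear_combination (- a ^ (M + 1) * (∏ i ∈ range M, u i)) * hV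

/-! ### The q-binomial theorem and the expansion of the crank product. -/

/-- The truncated `q`-binomial series. -/
def qBinomSum (q : B) (y : ℕ → B) (c t : B) (M : ℕ) : B :=
  ∑ j ∈ range (M + 1), qPoch q c j * t ^ j * ∏ i ∈ range j, y i

lemma qBinomSum_sub {q : B} {y : ℕ → B} (hy : ∀ i, y i * (1 - q ^ (i + 1)) = 1) (c t : B) (M : ℕ) :
    (1 - t) * qBinomSum q y c t M - (1 - c * t) * qBinomSum q y c (t * q) M =
      - (qPoch q c (M + 1) * t ^ (M + 1) * ∏ i ∈ range M, y i) := by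
  induction M with
  | zero => simp [qBinomSum, qPoch]; ring
  | succ M ih =>
    rw [qBinomSum, sum_range_succ, qBinomSum, sum_range_succ _ (M + 1), ← qBinomSum, ← qBinomSum,
      qPoch_succ q c (M + 1), prod_range_succ]
    generalize ∏ i ∈ range M, y i = Y at *
    linear_combination ih + qPoch q c (M + 1) * t ^ (M + 1) * Y * hy M

lemma qBinomSum_zero (q : B) (y : ℕ → B) (c : B) (M : ℕ) : qBinomSum q y c 0 M = 1 := by
  rw [qBinomSum, sum_range_succ']
  simp

/-- The q-binomial theorem, by iterating t → tq until t vanishes. The extra factor q in the argument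
makes the boundary term of `qBinomSum_sub` nilpotent of the right order, hence zero. -/
lemma qBinomSum_mul_qPoch {q : B} {M : ℕ} (hq : q ^ (M + 1) = 0) {y : ℕ → B}
    (hy : ∀ i, y i * (1 - q ^ (i + 1)) = 1) (c w : B) :
    qBinomSum q y c (w * q) M * qPoch q (w * q) M = qPoch q (c * (w * q)) M := by
  have key (n : ℕ) : qBinomSum q y c (w * q) M * qPoch q (w * q) n =
      qPoch q (c * (w * q)) n * qBinomSum q y c (w * q ^ (n + 1)) M := by
    induction n with
    | zero => simp
    | succ n ih =>
      have h := qBinomSum_sub hy c (w * q ^ (n + 1)) M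
      have h0 : (w * q ^ (n + 1)) ^ (M + 1) = 0 := by
        rw [mul_pow, ← pow_mul, mul_comm (n + 1), pow_mul, hq, zero_pow (by simp), mul_zero]
      rw [h0, mul_assoc w, ← pow_succ] at h
      rw [qPoch_succ, qPoch_succ]
      linear_combination (1 - w * q * q ^ n) * ih + qPoch q (c * (w * q)) n * h
  rw [key, hq, mul_zero, qBinomSum_zero, mul_one]

/-- The crank product expanded according to the number of ones, truncated by `q ^ (M + 1) = 0`. -/
theorem crankProduct_eq {q z a : B} {M : ℕ} (hq : q ^ (M + 1) = 0) (haz : a * z = 1)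
    {u v y : ℕ → B} (hu : ∀ i, u i * (1 - z * q ^ (i + 1)) = 1)
    (hv : ∀ i, v i * (1 - a * q ^ (i + 1)) = 1) (hy : ∀ i, y i * (1 - q ^ (i + 1)) = 1) :
    ∏ i ∈ range M, ((1 - q ^ (i + 1)) * (u i * v i)) =
      (1 - q) * ∑ N ∈ range (M + 1), (z * q) ^ N * ∏ i ∈ range N, y i +
      ∑ j ∈ range M, (a * q) ^ (j + 1) * ((1 - q) * ∏ i ∈ range (j + 1), y i) *
        ∏ i ∈ Ico (j + 1) M, u i := by
  have hU := prod_mul_qPoch_of_inv hu M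
  have hV := prod_mul_qPoch_of_inv hv M
  have euler := qBinomSum_mul_qPoch hq hy 0 z
  have binom := qBinomSum_mul_qPoch hq hy (z * q) a
  rw [zero_mul, qPoch_zero_left] at euler
  have hEuler : ∑ N ∈ range (M + 1), (z * q) ^ N * ∏ i ∈ range N, y i = ∏ i ∈ range M, u i := by
    have : qBinomSum q y 0 (z * q) M = ∑ N ∈ range (M + 1), (z * q) ^ N * ∏ i ∈ range N, y i := by
      simp [qBinomSum, qPoch_zero_left]
    rw [this] at euler
    generalize ∏ i ∈ range M, u i = U at *
    generalize ∑ N ∈ range (M + 1), (z * q) ^ N * ∏ i ∈ range N, y i = E at *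
    linear_combination U * euler - E * hU
  -- The choice c = zq, t = aq gives ct = q², so the numerator is the crank numerator up to 1 - q.
  have hqq : (1 - q) * qPoch q (z * q * (a * q)) M = ∏ i ∈ range M, (1 - q ^ (i + 1)) := by
    have h1 : z * q * (a * q) = q * q := by linear_combination q * q * haz
    rw [h1, ← qPoch_succ', qPoch_succ, ← pow_succ', hq, sub_zero, mul_one, qPoch]
    exact prod_congr rfl fun i _ => by ring
  have hexp : (∏ i ∈ range M, u i) * qBinomSum q y (z * q) (a * q) M = ∏ i ∈ range M, u i +
      ∑ j ∈ range M, (a * q) ^ (j + 1) * (∏ i ∈ range (j + 1), y i) * ∏ i ∈ Ico (j + 1) M, u i := by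
    rw [qBinomSum, sum_range_succ', add_comm, mul_add, mul_sum]
    congr 1
    · simp
    · refine sum_congr rfl fun j hj => ?_
      have hj' : j + 1 ≤ M := by simpa using hj
      rw [← prod_range_mul_prod_Ico _ hj']
      linear_combination ((a * q) ^ (j + 1) * (∏ i ∈ range (j + 1), y i) *
        ∏ i ∈ Ico (j + 1) M, u i) * prod_mul_qPoch_of_inv hu (j + 1)
  rw [prod_mul_distrib, prod_mul_distrib, ← hqq, hEuler, ← binom]
  have : ∑ j ∈ range M, (a * q) ^ (j + 1) * ((1 - q) * ∏ i ∈ range (j + 1), y i) *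
        ∏ i ∈ Ico (j + 1) M, u i = (1 - q) * ∑ j ∈ range M, (a * q) ^ (j + 1) *
          (∏ i ∈ range (j + 1), y i) * ∏ i ∈ Ico (j + 1) M, u i := by
    rw [mul_sum]
    exact sum_congr rfl fun _ _ => by ring
  rw [this, ← mul_add, ← hexp]
  linear_combination ((1 - q) * qBinomSum q y (z * q) (a * q) M * (∏ i ∈ range M, u i)) * hV

end QSeries

end PartitionMoments

namespace PartitionMoments

/-! ### Rank and crank generating functions from partitions. -/

section GeneratingFunctions

variable {A : Type*} [CommRing A]

/-- The power series `1 / (1 - c X^{i+1})`. -/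
noncomputable def geoInv (c : A) (i : ℕ) : A⟦X⟧ := invOfUnit (1 - C c * X ^ (i + 1)) 1

lemma geoInv_mul (c : A) (i : ℕ) : geoInv c i * (1 - C c * X ^ (i + 1)) = 1 := by
  rw [mul_comm, geoInv]
  exact mul_invOfUnit _ _ (by simp)

lemma geoInv_zero (i : ℕ) : geoInv (0 : A) i = 1 := by
  simpa using geoInv_mul (0 : A) i

section Topology

open scoped PowerSeries.WithPiTopology

variable [TopologicalSpace A] [T2Space A]

lemma sum_partition_eq_coeff_prod (f : ℕ → ℕ → A) {n M : ℕ} (h : n ≤ M) :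
    ∑ p : n.Partition, p.parts.toFinsupp.prod f =
      coeff n (∏ i ∈ range M, (1 + ∑' j, f (i + 1) (j + 1) • (X : A⟦X⟧) ^ ((i + 1) * (j + 1)))) := by
  -- Giving weight 0 to parts above M, absent from partitions of n ≤ M, makes the infinite product
  -- finite.
  set g : ℕ → ℕ → A := fun i c => if i ≤ M then f i c else 0 with hg
  have h1 : ∑ p : n.Partition, p.parts.toFinsupp.prod f = coeff n (Nat.Partition.genFun g) := by
    rw [Nat.Partition.coeff_genFun]
    refine sum_congr rfl fun p _ => Finsupp.prod_congr fun i hi => ?_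
    have : i ∈ p.parts := by simpa using hi
    simp [hg, (Nat.Partition.le_of_mem_parts this).trans h]
  rw [h1, Nat.Partition.genFun_eq_tprod, tprod_eq_prod (s := range M)]
  · congr 1
    refine prod_congr rfl fun i hi => ?_
    have : i + 1 ≤ M := by simpa using hi
    simp [hg, this]
  · intro i hi
    have : ¬ i + 1 ≤ M := by simpa using hi
    simp [hg, this]

lemma one_add_tsum_pow_eq_geoInv [IsTopologicalRing A] (c : A) (i : ℕ) :
    1 + ∑' j, c ^ (j + 1) • (X : A⟦X⟧) ^ ((i + 1) * (j + 1)) = geoInv c i := by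
  have h0 : constantCoeff (C c * (X : A⟦X⟧) ^ (i + 1)) = 0 := by simp
  have h1 : 1 + ∑' j, c ^ (j + 1) • (X : A⟦X⟧) ^ ((i + 1) * (j + 1)) =
      ∑' j, (C c * (X : A⟦X⟧) ^ (i + 1)) ^ j := by
    rw [(WithPiTopology.summable_pow_of_constantCoeff_eq_zero h0).tsum_eq_zero_add, pow_zero]
    congr 2
    ext1 j
    rw [mul_pow, ← pow_mul, smul_eq_C_mul, map_pow]
  have h2 := WithPiTopology.tsum_pow_mul_one_sub_of_constantCoeff_eq_zero h0
  rw [h1]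
  linear_combination geoInv c i * h2 -
    (∑' j, (C c * (X : A⟦X⟧) ^ (i + 1)) ^ j) * geoInv_mul c i

end Topology

/-- The generating function of partitions weighted multiplicatively by their parts. -/
theorem sum_partition_prod (w : ℕ → A) {n M : ℕ} (h : n ≤ M) :
    ∑ p : n.Partition, (p.parts.map w).prod = coeff n (∏ i ∈ range M, geoInv (w (i + 1)) i) := by
  let _ : TopologicalSpace A := ⊥
  have _ : DiscreteTopology A := ⟨rfl⟩
  have := sum_partition_eq_coeff_prod (fun i c => w i ^ c) h
  simp_rw [one_add_tsum_pow_eq_geoInv] at this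
  rw [← this]
  refine sum_congr rfl fun p _ => ?_
  rw [Finset.prod_multiset_map_count, Finsupp.prod]
  simp

open scoped PowerSeries.WithPiTopology in
/-- The generating function of partitions with exactly `j` ones, weighted multiplicatively. -/
theorem sum_partition_prod_count_one (w : ℕ → A) (hw : w 1 = 1) {n M j : ℕ} (hj : j ≠ 0)
    (hM : 1 ≤ M) (h : n ≤ M) :
    ∑ p : n.Partition with p.parts.count 1 = j, (p.parts.map w).prod =
      coeff n (X ^ j * ∏ i ∈ Ico 1 M, geoInv (w (i + 1)) i) := by
  let _ : TopologicalSpace A := ⊥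
  have _ : DiscreteTopology A := ⟨rfl⟩
  have split (F : ℕ → A⟦X⟧) : ∏ i ∈ range M, F i = F 0 * ∏ i ∈ Ico 1 M, F i := by
    rw [range_eq_Ico, prod_eq_prod_Ico_succ_bot hM]
  -- Absence of ones always has weight 1 here, so the factor for ones is 1 + X^j; the partitions
  -- without ones (`h2`) are then subtracted.
  have h1 := sum_partition_eq_coeff_prod
    (fun i c => if i = 1 then (if c = j then 1 else 0) else w i ^ c) h
  have h2 := sum_partition_prod (fun i => if i = 1 then 0 else w i) h
  rw [split] at h1 h2
  have e0 : 1 + ∑' c, (if c + 1 = j then (1 : A) else 0) • (X : A⟦X⟧) ^ (c + 1) = 1 + X ^ j := by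
    rw [tsum_eq_single (j - 1) (fun c hc => by rw [if_neg (by omega), zero_smul]),
      if_pos (by omega), one_smul, Nat.sub_add_cancel (by omega)]
  have e1 : ∏ i ∈ Ico 1 M, (1 + ∑' c, (if i + 1 = 1 then (if c + 1 = j then (1 : A) else 0)
      else w (i + 1) ^ (c + 1)) • (X : A⟦X⟧) ^ ((i + 1) * (c + 1))) =
      ∏ i ∈ Ico 1 M, geoInv (w (i + 1)) i := by
    refine prod_congr rfl fun i hi => ?_
    have : i ≠ 0 := by simp at hi; omega
    simp [this, one_add_tsum_pow_eq_geoInv]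
  have e2 : ∏ i ∈ Ico 1 M, geoInv (if i + 1 = 1 then 0 else w (i + 1)) i =
      ∏ i ∈ Ico 1 M, geoInv (w (i + 1)) i := by
    refine prod_congr rfl fun i hi => ?_
    have : i ≠ 0 := by simp at hi; omega
    simp [this]
  rw [e1] at h1
  rw [e2] at h2
  simp only [zero_add, one_mul, if_true, e0] at h1
  simp only [zero_add, if_true, geoInv_zero, one_mul] at h2
  have h3 : coeff n (X ^ j * ∏ i ∈ Ico 1 M, geoInv (w (i + 1)) i) =
      coeff n ((1 + X ^ j) * ∏ i ∈ Ico 1 M, geoInv (w (i + 1)) i) -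
        coeff n (∏ i ∈ Ico 1 M, geoInv (w (i + 1)) i) := by
    rw [← map_sub]; congr 1; ring
  rw [h3, ← h1, ← h2, ← sum_sub_distrib, sum_filter]
  refine sum_congr rfl fun p _ => ?_
  rw [Finset.prod_multiset_map_count, Finset.prod_multiset_map_count, Finsupp.prod]
  simp only [Multiset.toFinsupp_support, Multiset.toFinsupp_apply]
  by_cases hp : 1 ∈ p.parts
  · have hp' : 1 ∈ p.parts.toFinset := by simpa using hp
    rw [prod_eq_zero (f := fun m => (if m = 1 then 0 else w m) ^ p.parts.count m) hp' (by simp [hp]),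
      sub_zero]
    by_cases hc : p.parts.count 1 = j
    · rw [if_pos hc]
      refine prod_congr rfl fun i _ => ?_
      split_ifs with hi1 hi2
      · simp [hi1, hw, hc]
      · exact absurd (hi1 ▸ hc) hi2
      · rfl
    · rw [if_neg hc, prod_eq_zero hp' (by simp [hc])]
  · have hne : p.parts.count 1 ≠ j := by
      rw [Multiset.count_eq_zero_of_notMem hp]; exact hj.symm
    rw [if_neg hne, eq_comm, sub_eq_zero]
    refine prod_congr rfl fun i hi => ?_
    have : i ≠ 1 := by rintro rfl; exact hp (by simpa using hi)
    simp [this]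

lemma prod_map_ite_eq_pow_countP {P : ℕ → Prop} [DecidablePred P] (z : A) (s : Multiset ℕ) :
    (s.map fun i => if P i then z else 1).prod = z ^ s.countP P := by
  induction s using Multiset.induction_on with
  | empty => simp
  | cons i s ih =>
    rw [Multiset.map_cons, Multiset.prod_cons, ih]
    by_cases h : P i
    · simp [h, pow_succ']
    · simp [h]

lemma prod_map_ite_eq_pow_card {P : ℕ → Prop} [DecidablePred P] (z : A) (s : Multiset ℕ) :
    (s.map fun i => if P i then z else 0).prod =
      if ∀ i ∈ s, P i then z ^ Multiset.card s else 0 := by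
  induction s using Multiset.induction_on with
  | empty => simp
  | cons i s ih =>
    rw [Multiset.map_cons, Multiset.prod_cons, ih]
    by_cases h : P i
    · simp [h, pow_succ']
    · simp [h]

lemma sum_mul_ite_sub_ite (c : ℕ → A) {s k M : ℕ} (hk : k < s) (hM : s ≤ M) :
    ∑ N ∈ Ico k M, c (N + 1) * ((if s ≤ N + 1 then 1 else 0) - (if s ≤ N then 1 else 0)) = c s := by
  rw [sum_eq_single (s - 1)]
  · rw [if_pos (by omega), if_neg (by omega), Nat.sub_add_cancel (by omega)]; ring
  · intro N _ hN
    by_cases h : s ≤ N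
    · rw [if_pos (by omega), if_pos h]; ring
    · rw [if_neg (by omega), if_neg h]; ring
  · intro h; simp at h; omega

lemma sup_parts_pos {n : ℕ} (hn : n ≠ 0) (p : n.Partition) : 0 < p.parts.sup := by
  have h : p.parts ≠ 0 := by
    intro h; apply hn; rw [← p.parts_sum, h]; simp
  obtain ⟨i, hi⟩ := Multiset.exists_mem_of_ne_zero h
  exact (p.parts_pos hi).trans_le (Multiset.le_sup hi)

lemma sup_parts_le {n : ℕ} (p : n.Partition) : p.parts.sup ≤ n :=
  Multiset.sup_le.2 fun _ hi => Nat.Partition.le_of_mem_parts hi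

lemma card_parts_le {n : ℕ} (p : n.Partition) : Multiset.card p.parts ≤ n := by
  simpa [p.parts_sum] using
    Multiset.card_nsmul_le_sum (s := p.parts) (a := 1) (fun i hi => p.parts_pos hi)

/-- The generating function of partitions weighted by `z ^ (number of parts) a ^ (largest part)`. -/
theorem sum_partition_rankWeight {z a : A} (haz : a * z = 1) {n M : ℕ} (hn : n ≠ 0) (h : n ≤ M) :
    ∑ p : n.Partition, z ^ Multiset.card p.parts * a ^ p.parts.sup =
      coeff n (1 + ∑ j ∈ range M, C a ^ j * X ^ (j + 1) * ∏ i ∈ range (j + 1), geoInv z i) := by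
  have key (N : ℕ) (hN : N ≤ M) : coeff n (∏ i ∈ range N, geoInv z i) =
      ∑ p : n.Partition, z ^ Multiset.card p.parts * if p.parts.sup ≤ N then 1 else 0 := by
    have h1 := sum_partition_prod (fun i => if i ≤ N then z else 0) h
    rw [← prod_range_mul_prod_Ico _ hN,
      prod_eq_one (s := Ico N M) (fun i hi => by
        rw [if_neg (by simp at hi; omega), geoInv_zero]), mul_one,
      prod_congr (s₂ := range N) (g := fun i => geoInv z i) rfl (fun i hi => by
        rw [if_pos (by simp at hi; omega)])] at h1
    rw [← h1]
    refine sum_congr rfl fun p _ => ?_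
    simp only [prod_map_ite_eq_pow_card, ← Multiset.sup_le, mul_ite, mul_one, mul_zero]
  -- The difference of the bounds j + 1 and j on the parts isolates largest part j + 1.
  have step (j : ℕ) : C a ^ j * X ^ (j + 1) * ∏ i ∈ range (j + 1), geoInv z i =
      C (a ^ (j + 1)) * (∏ i ∈ range (j + 1), geoInv z i - ∏ i ∈ range j, geoInv z i) := by
    have haz' : C a * C z = (1 : A⟦X⟧) := by rw [← map_mul, haz, map_one]
    rw [map_pow, prod_range_succ]
    linear_combination (- C a ^ j * X ^ (j + 1) * (∏ i ∈ range j, geoInv z i) * geoInv z j) * haz' -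
      (C a ^ (j + 1) * (∏ i ∈ range j, geoInv z i)) * geoInv_mul z j
  simp_rw [step]
  rw [map_add, coeff_one, if_neg hn, zero_add, map_sum]
  have (j : ℕ) (hj : j ∈ range M) : coeff n (C (a ^ (j + 1)) *
      (∏ i ∈ range (j + 1), geoInv z i - ∏ i ∈ range j, geoInv z i)) =
      ∑ p : n.Partition, z ^ Multiset.card p.parts * (a ^ (j + 1) *
        ((if p.parts.sup ≤ j + 1 then 1 else 0) - if p.parts.sup ≤ j then 1 else 0)) := by
    have hj' : j < M := by simpa using hj
    rw [coeff_C_mul, map_sub, key _ hj', key _ hj'.le, ← sum_sub_distrib, mul_sum]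
    exact sum_congr rfl fun p _ => by ring
  rw [sum_congr rfl this, sum_comm]
  refine sum_congr rfl fun p _ => ?_
  rw [← mul_sum, range_eq_Ico, sum_mul_ite_sub_ite (fun N => a ^ N) (sup_parts_pos hn p)
    ((sup_parts_le p).trans h)]

/-- Partitions without ones, weighted by `z ^ (largest part)`. -/
theorem sum_partition_sup_of_count_one_eq_zero (z : A) {n M : ℕ} (hn : 2 ≤ n) (h : n ≤ M) :
    ∑ p : n.Partition with p.parts.count 1 = 0, z ^ p.parts.sup =
      coeff n ((1 - X) * ∑ N ∈ range (M + 1), (C z * X) ^ N * ∏ i ∈ range N, geoInv 1 i) := by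
  have hM : 1 ≤ M := by omega
  have hy (i : ℕ) : geoInv (1 : A) i * (1 - X ^ (i + 1)) = 1 := by simpa using geoInv_mul (1 : A) i
  have hy0 : geoInv (1 : A) 0 * (1 - X) = 1 := by simpa using hy 0
  have key (N : ℕ) (h1N : 1 ≤ N) (hN : N ≤ M) : coeff n (∏ i ∈ Ico 1 N, geoInv (1 : A) i) =
      ∑ p : n.Partition with p.parts.count 1 = 0, if p.parts.sup ≤ N then 1 else 0 := by
    have h1 := sum_partition_prod (fun i => if i ≠ 1 ∧ i ≤ N then (1 : A) else 0) h
    rw [← prod_range_mul_prod_Ico _ hN,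
      prod_eq_one (s := Ico N M) (fun i hi => by
        rw [if_neg (by simp at hi; omega), geoInv_zero]), mul_one, range_eq_Ico,
      prod_eq_prod_Ico_succ_bot h1N, if_neg (by simp), geoInv_zero, one_mul,
      prod_congr (s₂ := Ico 1 N) (g := fun i => geoInv 1 i) rfl (fun i hi => by
        rw [if_pos (by simp at hi; omega)])] at h1
    rw [← h1, sum_filter]
    refine sum_congr rfl fun p _ => ?_
    rw [prod_map_ite_eq_pow_card, one_pow, ← ite_and]
    congr 1
    rw [Multiset.count_eq_zero, Multiset.sup_le, eq_iff_iff]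
    constructor
    · exact fun H => ⟨fun h1 => (H 1 h1).1 rfl, fun i hi => (H i hi).2⟩
    · rintro ⟨ha, hb⟩ i hi
      exact ⟨fun h => ha (h ▸ hi), hb i hi⟩
  have hY (N : ℕ) : (1 - X) * ∏ i ∈ range (N + 1), geoInv (1 : A) i =
      ∏ i ∈ Ico 1 (N + 1), geoInv (1 : A) i := by
    rw [range_eq_Ico, prod_eq_prod_Ico_succ_bot (by omega)]
    linear_combination (∏ i ∈ Ico 1 (N + 1), geoInv (1 : A) i) * hy0
  have step (N : ℕ) (h1N : 1 ≤ N) : (1 - X) * ((C z * X) ^ (N + 1) * ∏ i ∈ range (N + 1), geoInv 1 i) =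
      C (z ^ (N + 1)) * (∏ i ∈ Ico 1 (N + 1), geoInv 1 i - ∏ i ∈ Ico 1 N, geoInv 1 i) := by
    rw [mul_left_comm, hY, prod_Ico_succ_top h1N, map_pow, mul_pow]
    linear_combination (- C z ^ (N + 1) * (∏ i ∈ Ico 1 N, geoInv 1 i)) * hy N
  have (N : ℕ) (hN : N ∈ Ico 1 M) : coeff n
      ((1 - X) * ((C z * X) ^ (N + 1) * ∏ i ∈ range (N + 1), geoInv 1 i)) =
      ∑ p : n.Partition with p.parts.count 1 = 0, (z ^ (N + 1) *
        ((if p.parts.sup ≤ N + 1 then 1 else 0) - if p.parts.sup ≤ N then 1 else 0)) := by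
    have hN' := mem_Ico.1 hN
    rw [step N hN'.1, coeff_C_mul, map_sub, key _ (by omega) (by omega), key _ hN'.1 hN'.2.le,
      ← sum_sub_distrib, mul_sum]
  -- The terms N = 0 and N = 1 are 1 - q and zq, without combinatorial meaning here; n ≥ 2 discards
  -- them.
  have e1 : coeff n ((1 - X) * ((C z * X) ^ (0 + 1) * ∏ i ∈ range (0 + 1), geoInv (1 : A) i)) = 0 := by
    rw [mul_left_comm, hY]
    simp [coeff_X, show n ≠ 1 by omega]
  have e0 : coeff n ((1 - X : A⟦X⟧) * ((C z * X) ^ 0 * ∏ i ∈ range 0, geoInv (1 : A) i)) = 0 := by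
    simp [coeff_X, coeff_one, show n ≠ 1 by omega, show n ≠ 0 by omega]
  rw [mul_sum, map_sum, sum_range_succ', e0, add_zero, range_eq_Ico,
    sum_eq_sum_Ico_succ_bot (by omega), e1, zero_add, zero_add, sum_congr rfl this, sum_comm]
  refine sum_congr rfl fun p hp => ?_
  have hp1 : p.parts.count 1 = 0 := (mem_filter.1 hp).2
  have hs : 1 < p.parts.sup := by
    have hpos := sup_parts_pos (by omega) p
    by_contra hlt
    obtain ⟨i, hi⟩ := Multiset.exists_mem_of_ne_zero (s := p.parts) (by
      rintro h0; rw [h0] at hpos; simp at hpos)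
    have := Multiset.le_sup hi
    have := p.parts_pos hi
    have : i = 1 := by omega
    exact Multiset.count_eq_zero.1 hp1 (this ▸ hi)
  rw [sum_mul_ite_sub_ite (fun N => z ^ N) hs ((sup_parts_le p).trans h)]

/-- The weight `z ^ (crank p)`, where `a` is the inverse of `z`. -/
def crankWeight (z a : A) {n : ℕ} (p : n.Partition) : A :=
  if p.parts.count 1 = 0 then z ^ p.parts.sup
  else z ^ p.parts.countP (fun i => p.parts.count 1 < i) * a ^ p.parts.count 1

/-- The generating function of partitions weighted by their crank. -/
theorem sum_partition_crankWeight (z a : A) {n M : ℕ} (hn : 2 ≤ n) (h : n ≤ M) :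
    ∑ p : n.Partition, crankWeight z a p =
      coeff n ((1 - X) * ∑ N ∈ range (M + 1), (C z * X) ^ N * ∏ i ∈ range N, geoInv 1 i +
      ∑ j ∈ range M, (C a * X) ^ (j + 1) * ((1 - X) * ∏ i ∈ range (j + 1), geoInv 1 i) *
        ∏ i ∈ Ico (j + 1) M, geoInv z i) := by
  have hM : 1 ≤ M := by omega
  have hy0 : geoInv (1 : A) 0 * (1 - X) = 1 := by simpa using geoInv_mul (1 : A) 0
  have term (j : ℕ) (hj : j ∈ range M) :
      coeff n ((C a * X) ^ (j + 1) * ((1 - X) * ∏ i ∈ range (j + 1), geoInv 1 i) *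
        ∏ i ∈ Ico (j + 1) M, geoInv z i) =
      ∑ p : n.Partition with p.parts.count 1 = j + 1, crankWeight z a p := by
    have hj' : j + 1 ≤ M := by simpa using hj
    have h1 := sum_partition_prod_count_one (fun i => if j + 1 < i then z else 1) (by simp)
      (Nat.succ_ne_zero j) hM h
    rw [← prod_Ico_consecutive _ (show 1 ≤ j + 1 by omega) hj',
      prod_congr (s₁ := Ico 1 (j + 1)) (g := fun i => geoInv 1 i) rfl (fun i hi => by
        rw [if_neg (by simp at hi; omega)]),
      prod_congr (s₁ := Ico (j + 1) M) (g := fun i => geoInv z i) rfl (fun i hi => by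
        rw [if_pos (by simp at hi; omega)])] at h1
    have h2 : (C a * X) ^ (j + 1) * ((1 - X) * ∏ i ∈ range (j + 1), geoInv 1 i) *
        ∏ i ∈ Ico (j + 1) M, geoInv z i = C (a ^ (j + 1)) * (X ^ (j + 1) *
          ((∏ i ∈ Ico 1 (j + 1), geoInv 1 i) * ∏ i ∈ Ico (j + 1) M, geoInv z i)) := by
      rw [range_eq_Ico, prod_eq_prod_Ico_succ_bot (by omega), map_pow, zero_add]
      linear_combination ((C a * X) ^ (j + 1) * (∏ i ∈ Ico 1 (j + 1), geoInv 1 i) *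
        ∏ i ∈ Ico (j + 1) M, geoInv z i) * hy0
    rw [h2, coeff_C_mul, ← h1, mul_sum]
    refine sum_congr rfl fun p hp => ?_
    have hp1 : p.parts.count 1 = j + 1 := (mem_filter.1 hp).2
    rw [prod_map_ite_eq_pow_countP, crankWeight, hp1, if_neg (by omega), mul_comm]
  rw [map_add, ← sum_partition_sup_of_count_one_eq_zero z hn h, map_sum, sum_congr rfl term]
  have h0 : ∑ p : n.Partition with p.parts.count 1 = 0, z ^ p.parts.sup =
      ∑ p : n.Partition with p.parts.count 1 = 0, crankWeight z a p :=
    sum_congr rfl fun p hp => by rw [crankWeight, if_pos (mem_filter.1 hp).2]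
  rw [h0, add_comm, ← sum_range_succ'
    (fun j => ∑ p : n.Partition with p.parts.count 1 = j, crankWeight z a p)]
  refine (sum_fiberwise_of_maps_to (fun p _ => ?_) _).symm
  have := (Multiset.count_le_card 1 p.parts).trans (card_parts_le p)
  rw [mem_range]
  omega

end GeneratingFunctions

end PartitionMoments

namespace PartitionMoments

/-! ### Transfer of the identity from the truncated ring to coefficients. -/

section Comparison

lemma map_sptSum {B B' : Type*} [CommRing B] [CommRing B'] (φ : B →+* B') (q : B) (d : ℕ → B)
    (M : ℕ) : φ (sptSum q d M) = sptSum (φ q) (fun i => φ (d i)) M := by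
  induction M with
  | zero => simp [sptSum]
  | succ M ih => simp [sptSum, ih]

variable {A : Type*} [CommRing A]

lemma coeff_eq_of_quotient_mk_eq {f g : A⟦X⟧} {n M : ℕ} (h : n ≤ M)
    (hfg : Ideal.Quotient.mk (Ideal.span {(X : A⟦X⟧) ^ (M + 1)}) f = Ideal.Quotient.mk _ g) :
    coeff n f = coeff n g := by
  rw [Ideal.Quotient.eq, Ideal.mem_span_singleton, X_pow_dvd_iff] at hfg
  have := hfg n (by omega)
  rwa [map_sub, sub_eq_zero] at this

/-- The rank and crank generating functions differ by `z + z⁻¹ - 2` times the spt-crank one. -/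
theorem sum_rankWeight_eq {z a : A} (haz : a * z = 1) {n : ℕ} (hn : 2 ≤ n) :
    ∑ p : n.Partition, z ^ Multiset.card p.parts * a ^ p.parts.sup =
      ∑ p : n.Partition, crankWeight z a p -
        (z + a - 2) * coeff n (sptSum X (fun i => geoInv z i * geoInv a i) n) := by
  set φ := Ideal.Quotient.mk (Ideal.span {(X : A⟦X⟧) ^ (n + 1)}) with hφ
  have hq : φ X ^ (n + 1) = 0 := by
    rw [← map_pow, hφ, Ideal.Quotient.eq_zero_iff_mem]
    exact Ideal.mem_span_singleton_self _
  have haz' : φ (C a) * φ (C z) = 1 := by rw [← map_mul, ← map_mul, haz, map_one, map_one]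
  have inv (c : A) (i : ℕ) : φ (geoInv c i) * (1 - φ (C c) * φ X ^ (i + 1)) = 1 := by
    simpa using congrArg φ (geoInv_mul c i)
  have inv1 (i : ℕ) : φ (geoInv 1 i) * (1 - φ X ^ (i + 1)) = 1 := by simpa using inv 1 i
  have h1 := rankSeries_eq hq haz' (inv z) (inv a)
  rw [crankProduct_eq hq haz' (inv z) (inv a) inv1] at h1
  rw [sum_partition_rankWeight haz (by omega) le_rfl, sum_partition_crankWeight z a hn le_rfl,
    ← coeff_C_mul, ← map_sub]
  refine coeff_eq_of_quotient_mk_eq le_rfl ?_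
  rw [← hφ]
  have h2 : φ (C 2) = 2 := by rw [map_ofNat, map_ofNat]
  simpa [map_sptSum, h2] using h1

end Comparison

/-! ### Nonnegativity in q (outer variable) and t (inner variable). -/

section Positivity

/-- The bivariate rational power series with nonnegative coefficients. -/
def nonnegSeries : Subsemiring ℚ⟦X⟧⟦X⟧ where
  carrier := {f | ∀ n m, 0 ≤ coeff m (coeff n f)}
  zero_mem' := by simp
  one_mem' := by
    intro n m
    rw [coeff_one]
    split_ifs
    · rw [coeff_one]; split_ifs <;> simp
    · simp
  add_mem' := by
    intro f g hf hg n m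
    simpa using add_nonneg (hf n m) (hg n m)
  mul_mem' := by
    intro f g hf hg n m
    rw [coeff_mul, map_sum]
    refine sum_nonneg fun i _ => ?_
    rw [coeff_mul]
    exact sum_nonneg fun j _ => mul_nonneg (hf _ _) (hg _ _)

lemma X_mem_nonnegSeries : (X : ℚ⟦X⟧⟦X⟧) ∈ nonnegSeries := by
  intro n m
  rw [coeff_X]
  split_ifs
  · rw [coeff_one]; split_ifs <;> simp
  · simp

lemma C_mem_nonnegSeries {x : ℚ⟦X⟧} (hx : ∀ m, 0 ≤ coeff m x) : C x ∈ nonnegSeries := by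
  intro n m
  rw [coeff_C]
  split_ifs
  · exact hx m
  · simp

lemma inv_one_sub_mem_nonnegSeries {f g : ℚ⟦X⟧⟦X⟧} (hf : f ∈ nonnegSeries)
    (hf0 : constantCoeff f = 0) (hg : g * (1 - f) = 1) : g ∈ nonnegSeries := by
  have hg' : g = 1 + f * g := by linear_combination hg
  intro n
  induction n using Nat.strong_induction_on with
  | _ n ih =>
    intro m
    rw [hg', map_add, map_add, coeff_mul, map_sum]
    refine add_nonneg (nonnegSeries.one_mem n m) (sum_nonneg fun i hi => ?_)
    have hi' := mem_antidiagonal.1 hi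
    rcases Nat.eq_zero_or_pos i.1 with h0 | h0
    · rw [h0, coeff_zero_eq_constantCoeff_apply, hf0, zero_mul, map_zero]
    · rw [coeff_mul]
      exact sum_nonneg fun j _ => mul_nonneg (hf _ _) (ih _ (by omega) _)

variable {z a : ℚ⟦X⟧}

lemma geoInv_one_mem_nonnegSeries (i : ℕ) : geoInv (1 : ℚ⟦X⟧) i ∈ nonnegSeries :=
  inv_one_sub_mem_nonnegSeries (pow_mem X_mem_nonnegSeries (i + 1)) (by simp)
    (by simpa using geoInv_mul (1 : ℚ⟦X⟧) i)

/-- Each factor `(1 - q^m) / ((1 - z q^m) (1 - z⁻¹ q^m))` is `1` plus a nonnegative series. -/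
lemma exists_factor_eq (haz : a * z = 1) (hx : ∀ m, 0 ≤ coeff m (z + a - 2)) (i : ℕ) :
    ∃ h ∈ nonnegSeries, (1 - X ^ (i + 1)) * (geoInv z i * geoInv a i) = 1 + h := by
  have haz' : C a * C z = (1 : ℚ⟦X⟧⟦X⟧) := by rw [← map_mul, haz, map_one]
  have hy := geoInv_mul (1 : ℚ⟦X⟧) i
  rw [map_one, one_mul] at hy
  -- With Q = q^(i+1) and x = z + a - 2, (1 - zQ)(1 - aQ) = (1 - Q)² - xQ; dividing by 1 - Q gives 1
  -- - f.
  set f : ℚ⟦X⟧⟦X⟧ := X ^ (i + 1) + C (z + a - 2) * X ^ (i + 1) * geoInv 1 i with hf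
  have hfmem : f ∈ nonnegSeries :=
    add_mem (pow_mem X_mem_nonnegSeries _)
      (mul_mem (mul_mem (C_mem_nonnegSeries hx) (pow_mem X_mem_nonnegSeries _))
        (geoInv_one_mem_nonnegSeries i))
  set g : ℚ⟦X⟧⟦X⟧ := (1 - X ^ (i + 1)) * (geoInv z i * geoInv a i) with hg
  have hD : geoInv z i * geoInv a i * ((1 - X ^ (i + 1)) ^ 2 - C (z + a - 2) * X ^ (i + 1)) = 1 := by
    have h2 : C (z + a - 2) = (C z + C a - 2 : ℚ⟦X⟧⟦X⟧) := by
      rw [map_sub, map_add, map_ofNat]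
    rw [h2]
    linear_combination (geoInv a i * (1 - C a * X ^ (i + 1))) * geoInv_mul z i + geoInv_mul a i -
      (geoInv z i * geoInv a i * X ^ (i + 1) * X ^ (i + 1)) * haz'
  have hgf : g * (1 - f) = 1 := by
    rw [hf, hg]
    linear_combination hD -
      (geoInv z i * geoInv a i * C (z + a - 2) * X ^ (i + 1)) * hy
  have hgmem := inv_one_sub_mem_nonnegSeries hfmem (by simp [hf]) hgf
  exact ⟨f * g, mul_mem hfmem hgmem, by linear_combination hgf⟩

/-- Subtracting q/(1 - q), the leading part of the first summand, records that every positive power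
of q occurs with t-constant coefficient at least 1. -/
lemma sptSum_sub_mem_nonnegSeries (haz : a * z = 1) (hx : ∀ m, 0 ≤ coeff m (z + a - 2)) (M : ℕ) :
    sptSum X (fun i => geoInv z i * geoInv a i) (M + 1) - X * geoInv 1 0 ∈ nonnegSeries := by
  have last (i : ℕ) : ∃ h ∈ nonnegSeries,
      X ^ (i + 1) * (geoInv z i * geoInv a i) = X ^ (i + 1) * geoInv 1 i + h := by
    obtain ⟨h, hh, e⟩ := exists_factor_eq haz hx i
    refine ⟨X ^ (i + 1) * geoInv 1 i * h, mul_mem (mul_mem (pow_mem X_mem_nonnegSeries _)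
      (geoInv_one_mem_nonnegSeries i)) hh, ?_⟩
    have hy := geoInv_mul (1 : ℚ⟦X⟧) i
    rw [map_one, one_mul] at hy
    linear_combination (X ^ (i + 1) * geoInv 1 i) * e -
      X ^ (i + 1) * (geoInv z i * geoInv a i) * hy
  induction M with
  | zero =>
    obtain ⟨h, hh, e⟩ := last 0
    rw [zero_add, pow_one] at e
    simpa [sptSum, e] using hh
  | succ M ih =>
    obtain ⟨h, hh, e⟩ := last (M + 1)
    obtain ⟨h', hh', e'⟩ := exists_factor_eq haz hx (M + 1)
    have hX : X * geoInv 1 0 ∈ nonnegSeries :=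
      mul_mem X_mem_nonnegSeries (geoInv_one_mem_nonnegSeries 0)
    have hS := add_mem ih hX
    rw [sub_add_cancel] at hS
    rw [sptSum, e, e']
    have := add_mem (add_mem ih (mul_mem hS hh')) (add_mem (mul_mem
      (pow_mem X_mem_nonnegSeries (M + 1 + 1)) (geoInv_one_mem_nonnegSeries (M + 1))) hh)
    convert this using 1
    ring

lemma coeff_X_mul_geoInv_one {n : ℕ} (hn : n ≠ 0) : coeff n (X * geoInv (1 : ℚ⟦X⟧) 0) = 1 := by
  have hy : geoInv (1 : ℚ⟦X⟧) 0 = PowerSeries.mk 1 := by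
    have h1 := geoInv_mul (1 : ℚ⟦X⟧) 0
    have h2 := mk_one_mul_one_sub_eq_one ℚ⟦X⟧
    rw [map_one, one_mul, zero_add, pow_one] at h1
    linear_combination (PowerSeries.mk 1 : ℚ⟦X⟧⟦X⟧) * h1 - geoInv 1 0 * h2
  obtain ⟨m, rfl⟩ := Nat.exists_eq_succ_of_ne_zero hn
  rw [Nat.succ_eq_add_one, coeff_succ_X_mul, hy, coeff_mk, Pi.one_apply]

lemma coeff_sptSum_nonneg (haz : a * z = 1) (hx : ∀ m, 0 ≤ coeff m (z + a - 2)) {n : ℕ}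
    (hn : n ≠ 0) (m : ℕ) :
    (if m = 0 then 1 else 0) ≤
      coeff m (coeff n (sptSum X (fun i => geoInv z i * geoInv a i) n)) := by
  obtain ⟨M, rfl⟩ := Nat.exists_eq_succ_of_ne_zero hn
  have h := sptSum_sub_mem_nonnegSeries haz hx M (M + 1) m
  rw [map_sub, map_sub, coeff_X_mul_geoInv_one hn, coeff_one] at h
  exact sub_nonneg.1 h

end Positivity

/-! ### Moments as coefficients at z = e^t. -/

section Moments

lemma coeff_exp_pow_mul (k l j : ℕ) :
    coeff j (exp ℚ ^ k * evalNegHom (exp ℚ) ^ l) = ((k : ℚ) - l) ^ j / j.factorial := by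
  have h : evalNegHom (exp ℚ) ^ l = rescale (-(l : ℚ)) (exp ℚ) := by
    rw [← map_pow, exp_pow_eq_rescale_exp, evalNegHom, rescale_rescale]
    congr 2; ring
  rw [h, exp_pow_eq_rescale_exp, exp_mul_exp_eq_exp_add, coeff_rescale, coeff_exp, ← sub_eq_add_neg]
  simp [div_eq_mul_inv]

lemma coeff_exp_add_evalNeg (m : ℕ) :
    coeff m (exp ℚ + evalNegHom (exp ℚ) - 2) =
      (1 + (-1 : ℚ) ^ m) / m.factorial - if m = 0 then 2 else 0 := by
  have h1 := coeff_exp_pow_mul 1 0 m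
  have h2 := coeff_exp_pow_mul 0 1 m
  simp only [pow_one, pow_zero, mul_one, one_mul, Nat.cast_one, Nat.cast_zero, sub_zero, zero_sub,
    one_pow] at h1 h2
  rw [map_sub, map_add, h1, h2, ← add_div, ← map_ofNat C 2, coeff_C]

lemma coeff_exp_add_evalNeg_nonneg (m : ℕ) : 0 ≤ coeff m (exp ℚ + evalNegHom (exp ℚ) - 2) := by
  rw [coeff_exp_add_evalNeg]
  split_ifs with h
  · subst h; norm_num
  · rw [sub_zero]
    refine div_nonneg ?_ (by positivity)
    rcases neg_one_pow_eq_or ℚ m with h | h <;> rw [h] <;> norm_num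

lemma moment_eq_sum {n : ℕ} (r : n.Partition → ℤ) (hr : ∀ p, r p ∈ Icc (-(n : ℤ)) n) (j : ℕ) :
    ∑ m ∈ Icc (-(n : ℤ)) n, m ^ j * ((univ.filter fun p => r p = m).card : ℤ) = ∑ p, r p ^ j := by
  rw [← sum_fiberwise_of_maps_to (s := univ) (t := Icc (-(n : ℤ)) n) (g := r) (fun p _ => hr p)]
  refine sum_congr rfl fun m _ => ?_
  rw [sum_congr rfl (g := fun _ => m ^ j) (fun p hp => by rw [(mem_filter.1 hp).2]), sum_const,
    nsmul_eq_mul, mul_comm]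

lemma rankMoment_eq (j n : ℕ) : rankMoment j n = ∑ p : n.Partition, rank p ^ j := by
  refine moment_eq_sum rank (fun p => ?_) j
  have h1 := sup_parts_le p
  have h2 := card_parts_le p
  rw [rank, mem_Icc]
  omega

lemma crankMoment_eq (j : ℕ) {n : ℕ} (hn : n ≠ 1) :
    crankMoment j n = ∑ p : n.Partition, crank p ^ j := by
  rw [← moment_eq_sum crank (fun p => ?_) j]
  · simp [crankMoment, crankCount, hn]
  · have h1 := sup_parts_le p
    have h2 := card_parts_le p
    have h3 := Multiset.count_le_card 1 p.parts
    have h4 := Multiset.countP_le_card (fun i => p.parts.count 1 < i) p.parts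
    rw [crank, mem_Icc]
    split_ifs <;> omega

/-- The weight is z to the power minus the rank; evenness removes the sign. -/
lemma coeff_rankWeight {j : ℕ} (hj : Even j) {n : ℕ} (p : n.Partition) :
    coeff j (exp ℚ ^ Multiset.card p.parts * evalNegHom (exp ℚ) ^ p.parts.sup) =
      (rank p : ℚ) ^ j / j.factorial := by
  rw [coeff_exp_pow_mul, rank, ← hj.neg_pow]
  push_cast
  rw [neg_sub]

lemma coeff_crankWeight (j : ℕ) {n : ℕ} (p : n.Partition) :
    coeff j (crankWeight (exp ℚ) (evalNegHom (exp ℚ)) p) = (crank p : ℚ) ^ j / j.factorial := by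
  rw [crankWeight, crank]
  split_ifs
  · simpa using coeff_exp_pow_mul p.parts.sup 0 j
  · rw [coeff_exp_pow_mul]; push_cast; rfl

lemma evalNeg_exp_mul_exp : evalNegHom (exp ℚ) * exp ℚ = 1 := by
  rw [mul_comm, exp_mul_exp_neg_eq_one]

lemma rankMoment_one {j : ℕ} (hj : j ≠ 0) : rankMoment j 1 = 0 := by
  rw [rankMoment_eq]
  simp [rank, hj]

lemma crankMoment_one {j : ℕ} (hj : Even j) (hj0 : j ≠ 0) : crankMoment j 1 = 2 := by
  have : Icc (-((1 : ℕ) : ℤ)) ((1 : ℕ) : ℤ) = {-1, 0, 1} := by decide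
  rw [crankMoment, this]
  simp [crankCount, hj.neg_pow, hj0]

end Moments

end PartitionMoments

open PartitionMoments

theorem mainTheorem2 (k n : ℕ) (hk : 1 ≤ k) (hn : 1 ≤ n) :
    PartitionMoments.rankMoment (2 * k) n < PartitionMoments.crankMoment (2 * k) n := by
  have hk0 : 2 * k ≠ 0 := by omega
  rcases Nat.lt_or_ge 1 n with hn2 | hn1
  swap
  -- For n = 1 the crank counts are conventional rather than a count of partitions, so this case is
  -- computed directly.
  · obtain rfl : n = 1 := by omega
    rw [rankMoment_one hk0, crankMoment_one (even_two_mul k) hk0]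
    norm_num
  have hfac : (0 : ℚ) < (2 * k).factorial := by positivity
  have key := congrArg (coeff (2 * k)) (sum_rankWeight_eq evalNeg_exp_mul_exp hn2)
  rw [map_sub, map_sum, map_sum, sum_congr rfl fun p _ => coeff_rankWeight (even_two_mul k) p,
    sum_congr rfl fun p _ => coeff_crankWeight (2 * k) p, ← sum_div, ← sum_div] at key
  have hpos : 0 < coeff (2 * k) ((exp ℚ + evalNegHom (exp ℚ) - 2) *
      coeff n (sptSum X (fun i => geoInv (exp ℚ) i * geoInv (evalNegHom (exp ℚ)) i) n)) := by
    have hs := coeff_sptSum_nonneg evalNeg_exp_mul_exp coeff_exp_add_evalNeg_nonneg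
      (show n ≠ 0 by omega)
    rw [coeff_mul]
    -- The strictly positive term pairs the coefficient 2/(2k)! of t^(2k) with the t-constant
    -- coefficient of S.
    refine sum_pos' (fun i _ => mul_nonneg (coeff_exp_add_evalNeg_nonneg _)
      (le_trans (by split_ifs <;> norm_num) (hs i.2))) ⟨(2 * k, 0), by simp, mul_pos ?_ ?_⟩
    · rw [coeff_exp_add_evalNeg, if_neg hk0, (even_two_mul k).neg_one_pow, sub_zero]
      positivity
    · exact lt_of_lt_of_le (by simp) (hs 0)
  have hlt : (∑ p : n.Partition, (rank p : ℚ) ^ (2 * k)) / (2 * k).factorial <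
      (∑ p : n.Partition, (crank p : ℚ) ^ (2 * k)) / (2 * k).factorial := by
    rw [key]; linarith
  rw [div_lt_div_iff_of_pos_right hfac] at hlt
  rw [rankMoment_eq, crankMoment_eq _ (by omega)]
  exact_mod_cast hlt
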